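/- Let $\mathbb S^3\subset\mathbb H$ be the unit sphere with its round metric, Levi-Civita connection $\nabla$, and the orientation for which the left-invariant orthonormal frame $u(g)=(gi,gj,gk)$ is positive. Let $\tilde u$ be a lift of $u$ to the (unique) spin structure of $\mathbb S^3$. The spin module is $\mathbb H$, on which $\mathrm{Im}\,\mathbb H=\mathbb R^3$ acts by left quaternionic multiplication, so that spinor fields are written $[\tilde u,f]$ with $f:\mathbb S^3\to\mathbb H$, and a tangent vector $X=gx\in T_g\mathbb S^3$ $(x\in\mathrm{Im}\,\mathbb H)$ acts by $X\cdot[\tilde u,f]=[\tilde u,xf]$. Let $\nabla$ also denote the spin connection induced by the Levi-Civita connection, and let $\Phi:=[\tilde u,1]$ (a Killing spinor of unit length, $\nabla_X\Phi=\tfrac12X\cdot\Phi$). A smooth spinor field $\Psi$ is called a generalized Killing spinor if there is a smooth field $A$ of symmetric endomorphisms of $T\mathbb S^3$ with $\nabla_X\Psi=A(X)\cdot\Psi$ for all tangent vectors $X$. Let $V$ be a smooth vector field and $\alpha$ a smooth real function on $\mathbb S^3$. Then $\Psi:=V\cdot\Phi+\alpha\Phi$ is a generalized Killing spinor of unit length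 if and only if the following three conditions hold on $\mathbb S^3$: (i) $\alpha^2+|V|^2=1$, (ii) $-V\lrcorner *\nabla_VV-V(\alpha)V+\alpha\nabla_VV+d\alpha=0$, (iii) $\alpha *(V\wedge dV)+(2\alpha-\delta V)(1-\alpha^2)+\alpha V(\alpha)=0$. Here vectors and 1-forms are identified by means of the metric, $*$ is the Hodge star of the oriented Riemannian manifold $\mathbb S^3$ (so $*W=W\lrcorner\mathrm{vol}$ for a vector $W$), $V(\alpha)=d\alpha(V)$, and $\delta V=-\sum_i\langle\nabla_{e_i}V,e_i\rangle$ for any orthonormal frame $(e_i)$ is the codifferential of $V$. -/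

import Mathlib

open Module Metric
open scoped Quaternion Manifold ContDiff InnerProductSpace

noncomputable section

namespace SphereSpin

/-! ### The round sphere `S³ ⊂ ℍ`, its tangent spaces and vector fields -/

instance factFinrankQuaternion : Fact (finrank ℝ ℍ[ℝ] = 3 + 1) :=
  ⟨Quaternion.finrank_eq_four⟩

/-- The unit sphere of the quaternions (with the smooth structure that Mathlib puts on it). -/
abbrev S3 : Type := sphere (0 : ℍ[ℝ]) 1

/-- The tangent space `T_g S³`, as the subspace `g^⊥ = g · Im ℍ` of `ℍ`. Its inner product, the
restriction of the one of `ℍ`, is the round metric of sectional curvature 1. -/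
abbrev T (g : S3) : Submodule ℝ ℍ[ℝ] := (ℝ ∙ (g : ℍ[ℝ]))ᗮ

/-- The differential of the inclusion `S³ → ℍ` identifies Mathlib's tangent space with `T g`. -/
def tangentEquiv (g : S3) : TangentSpace (𝓡 3) g ≃ₗ[ℝ] T g :=
  (LinearEquiv.ofInjective
    (mvfderiv (𝓡 3) (Subtype.val : S3 → ℍ[ℝ]) g : TangentSpace (𝓡 3) g →ₗ[ℝ] ℍ[ℝ])
    (injective_mvfderiv_subtypeVal_sphere g)).trans
  (LinearEquiv.ofEq _ _ (range_mvfderiv_subtypeVal g))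

/-- Directional derivative `X(f)` of a function `f` on `S³` with values in a normed space. -/
def dirDeriv {E : Type*} [NormedAddCommGroup E] [NormedSpace ℝ E] (f : S3 → E) (g : S3) :
    T g →ₗ[ℝ] E :=
  (mvfderiv (𝓡 3) f g : TangentSpace (𝓡 3) g →ₗ[ℝ] E) ∘ₗ (tangentEquiv g).symm.toLinearMap

/-- Smooth functions on `S³`. -/
def SmoothFun {E : Type*} [NormedAddCommGroup E] [NormedSpace ℝ E] (f : S3 → E) : Prop :=
  ContMDiff (𝓡 3) 𝓘(ℝ, E) ∞ f

/-- A (not necessarily smooth) vector field on `S³`. -/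
abbrev VField : Type := ∀ g : S3, T g

/-- Smoothness of a vector field on `S³`. -/
def SmoothVField (V : VField) : Prop := SmoothFun fun g => (V g : ℍ[ℝ])

/-- The Levi-Civita connection `X ↦ (∇_X V)_g` of the submanifold `S³ ⊂ ℍ`: the tangential part
of the directional derivative in `ℍ`. -/
def covDeriv (V : VField) (g : S3) : T g →ₗ[ℝ] T g :=
  (T g).orthogonalProjectionOnto.toLinearMap ∘ₗ dirDeriv (fun h => (V h : ℍ[ℝ])) g

/-! ### The left invariant frame and the orientation -/

/-- The basis `i, j, k` of `Im ℍ`. -/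
def unitQ : Fin 3 → ℍ[ℝ] := ![⟨0, 1, 0, 0⟩, ⟨0, 0, 1, 0⟩, ⟨0, 0, 0, 1⟩]

lemma mul_unitQ_mem (g : S3) (i : Fin 3) : (g : ℍ[ℝ]) * unitQ i ∈ T g := by
  rw [Submodule.mem_orthogonal_singleton_iff_inner_right, Quaternion.inner_def]
  simp only [Quaternion.re_mul, Quaternion.re_star, Quaternion.imI_star, Quaternion.imJ_star,
    Quaternion.imK_star, Quaternion.imI_mul, Quaternion.imJ_mul, Quaternion.imK_mul]
  fin_cases i <;> simp [unitQ] <;> ring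

/-- The left invariant vector fields `g ↦ g i, g j, g k`. -/
def leftField (i : Fin 3) : VField := fun g => ⟨(g : ℍ[ℝ]) * unitQ i, mul_unitQ_mem g i⟩

lemma orthonormal_leftField (g : S3) : Orthonormal ℝ fun i => leftField i g := by
  have hg : ‖(g : ℍ[ℝ])‖ = 1 := by simp
  have h2 : Quaternion.normSq (g : ℍ[ℝ]) = 1 := by
    rw [Quaternion.normSq_eq_norm_mul_self, hg, one_mul]
  rw [Quaternion.normSq_def'] at h2
  rw [orthonormal_iff_ite]
  intro i j
  rw [Submodule.coe_inner, Quaternion.inner_def]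
  simp only [leftField, Quaternion.re_mul, Quaternion.re_star, Quaternion.imI_star,
    Quaternion.imJ_star, Quaternion.imK_star, Quaternion.imI_mul, Quaternion.imJ_mul,
    Quaternion.imK_mul]
  fin_cases i <;> fin_cases j <;> simp [unitQ] <;> nlinarith

instance factFinrankT (g : S3) : Fact (finrank ℝ (T g) = 3) :=
  ⟨Submodule.finrank_orthogonal_span_singleton (ne_zero_of_mem_unit_sphere g)⟩

/-- The left invariant orthonormal frame `u(g) = (g i, g j, g k)` of `T_g S³`. -/
def frame (g : S3) : OrthonormalBasis (Fin 3) ℝ (T g) :=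
  OrthonormalBasis.mk (orthonormal_leftField g) (by
    rw [(orthonormal_leftField g).linearIndependent.span_eq_top_of_card_eq_finrank]
    rw [Fintype.card_fin, (factFinrankT g).out])

/-- The Riemannian volume form of `S³`, for the orientation in which `u` is positive. -/
def vol (g : S3) : (T g) [⋀^Fin 3]→ₗ[ℝ] ℝ := (frame g).toBasis.orientation.volumeForm

/-! ### Forms on `T_g S³` -/

/-- The 1-form `⟨W, ·⟩` given by a tangent vector `W`. -/
def flat {g : S3} (W : T g) : (T g) [⋀^Fin 1]→ₗ[ℝ] ℝ :=
  AlternatingMap.ofSubsingleton ℝ (T g) ℝ 0 (innerₛₗ ℝ W)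

/-- The differential at `g` of a function on `S³`, as a 1-form. -/
def dFun (α : S3 → ℝ) (g : S3) : (T g) [⋀^Fin 1]→ₗ[ℝ] ℝ :=
  AlternatingMap.ofSubsingleton ℝ (T g) ℝ 0 (dirDeriv α g)

/-- Interior product `W ⌟ η`. -/
def interior {g : S3} {n : ℕ} (W : T g) (η : (T g) [⋀^Fin (n + 1)]→ₗ[ℝ] ℝ) :
    (T g) [⋀^Fin n]→ₗ[ℝ] ℝ := η.curryLeft W

/-- Wedge product of (the 1-form dual to) `W` and an `n`-form:
`(W ∧ η)(X₀, …, Xₙ) = ∑ᵢ (-1)ⁱ ⟨W, Xᵢ⟩ η(X₀, …, omit Xᵢ, …, Xₙ)`. -/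
def wedge {g : S3} {n : ℕ} (W : T g) (η : (T g) [⋀^Fin n]→ₗ[ℝ] ℝ) :
    (T g) [⋀^Fin (n + 1)]→ₗ[ℝ] ℝ :=
  AlternatingMap.alternatizeUncurryFin ((innerₛₗ ℝ W).smulRight η)

/-- The Hodge star `* W = W ⌟ vol` of (the 1-form dual to) a tangent vector, a 2-form. -/
def starVec {g : S3} (W : T g) : (T g) [⋀^Fin 2]→ₗ[ℝ] ℝ := interior W (vol g)

/-- The Hodge star of a 3-form, the number `c` with `η = c • vol`. -/
def starTop {g : S3} (η : (T g) [⋀^Fin 3]→ₗ[ℝ] ℝ) : ℝ := η (frame g)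

/-- The exterior derivative `dV` of (the 1-form dual to) a vector field. In the coordinates `x_a`
of `ℍ = ℝ⁴` this 1-form is the restriction of `∑ V_a dx_a` to `S³`, hence `dV = ∑ dV_a ∧ dx_a`,
that is `dV(X, Y) = ⟨X(V), Y⟩ - ⟨Y(V), X⟩`. -/
def extD (V : VField) (g : S3) : (T g) [⋀^Fin 2]→ₗ[ℝ] ℝ :=
  AlternatingMap.alternatizeUncurryFin
    { toFun X := AlternatingMap.ofSubsingleton ℝ (T g) ℝ 0
        (innerₛₗ ℝ (dirDeriv (fun h => (V h : ℍ[ℝ])) g X) ∘ₗ (T g).subtype)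
      map_add' X Y := by ext; simp
      map_smul' c X := by ext; simp }

/-- The codifferential `δV = -∑ ⟨∇_{e_i} V, e_i⟩`. -/
def codiff (V : VField) (g : S3) : ℝ := -LinearMap.trace ℝ (T g) (covDeriv V g)

/-! ### Spinors

`S³` has a unique spin structure, and the left invariant frame `u` lifts to a global section `ũ`
of it. The spin module is `ℍ`, the vectors `i, j, k` of `ℝ³ = Im ℍ` acting by left quaternionic
multiplication. A spinor field `[ũ, f]` is given by its function `f : S³ → ℍ`. -/

/-- Spinor fields `[ũ, f]` on `S³`. -/
abbrev Spinor : Type := S3 → ℍ[ℝ]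

/-- Clifford multiplication by the tangent vector `X = g x` at `g`: the action of
`x = g⁻¹ X ∈ Im ℍ` on the spin module. -/
def clifford {g : S3} (X : T g) (φ : ℍ[ℝ]) : ℍ[ℝ] := ((g : ℍ[ℝ])⁻¹ * (X : ℍ[ℝ])) * φ

/-- The spin connection induced by the Levi-Civita connection:
`∇_X [ũ, f] = [ũ, X(f) + 1/4 ∑_{i,j} ⟨∇_X u_i, u_j⟩ e_i · e_j · f]`. -/
def spinDeriv (Ψ : Spinor) (g : S3) (X : T g) : ℍ[ℝ] :=
  dirDeriv Ψ g X + (1 / 4 : ℝ) • ∑ i : Fin 3, ∑ j : Fin 3,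
    ⟪covDeriv (leftField i) g X, leftField j g⟫_ℝ •
      clifford (leftField i g) (clifford (leftField j g) (Ψ g))

/-- `Ψ` is a generalized Killing spinor: `Ψ` is smooth and `∇_X Ψ = A(X) · Ψ` for all `X`, where
`A` is a smooth field of symmetric endomorphisms of the tangent spaces. -/
def IsGeneralizedKilling (Ψ : Spinor) : Prop :=
  SmoothFun Ψ ∧ ∃ A : ∀ g : S3, T g →ₗ[ℝ] T g,
    (∀ Y : VField, SmoothVField Y → SmoothVField fun g => A g (Y g)) ∧
    (∀ g, (A g).IsSymmetric) ∧
    ∀ (g : S3) (X : T g), spinDeriv Ψ g X = clifford (A g X) (Ψ g)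

/-- The Killing spinor `Φ = [ũ, 1]` of unit length. -/
def Phi : Spinor := fun _ => 1

/-- The spinor `V · Φ + α Φ`. -/
def spinorOf (V : VField) (α : S3 → ℝ) : Spinor :=
  fun g => clifford (V g) (Phi g) + α g • Phi g

end SphereSpin

end

/-! The left invariant frame trivializes everything: a spinor field is a function `f : S³ → ℍ`, and
its covariant derivative is `∇_X f = X(f) + ½ x f` for `X = g x` (`spinDeriv_eq`). If `|f| = 1`, then
`X(f) f̄` is purely imaginary, and `∇_X f = A(X) · f` holds exactly for the endomorphism
`A(g x) = g (X(f) f̄) + ½ g x`, which is smooth. Hence `f` is a generalized Killing spinor if and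
only if the matrix of `x ↦ X(f) f̄ ∈ Im ℍ` is symmetric at every point
(`isGeneralizedKilling_iff`), that is, if and only if the vector `ω` describing its antisymmetric
part vanishes.

For `f = v + α`, where `V = g v`, this vector is (`jacobian_sub_jacobian`), with `N = ∇V` and
`a = grad α`,

  `ω = α (curl V + 2 V) + V × a + (tr N) V - N V`.

The condition `|f| = 1` reads `α² + |V|² = 1`, and its derivative is `α a + Nᵀ V = 0`
(`constraint_deriv`). Modulo these two relations the left-hand side of the second condition is
`ω × V` (`secondForm_leftField`) and that of the third is `ω · V` (`third_eq`). Both vanish when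
`ω = 0`. Conversely they give `ω = 0` wherever `V ≠ 0`. At a point where `V = 0` the two
conditions say nothing, but `ω` is continuous, so it vanishes on the closure of `{V ≠ 0}`; and on
the interior of `{V = 0}` the function `f` is real, so that `X(f) f̄` has no imaginary part and
`ω = 0` again (`rotation_eq_zero`). -/

noncomputable section

namespace SphereSpin

/-! ### Directional derivatives through the radial extension -/

open scoped Classical in
/-- The radial projection `p ↦ p / ‖p‖` of `ℍ` onto `S³`; the value at `0` is arbitrary. -/
def radial (p : ℍ[ℝ]) : S3 :=
  if h : p ≠ 0 then ⟨‖p‖⁻¹ • p, by simp [norm_smul, h]⟩ else ⟨1, by simp⟩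

lemma coe_radial {p : ℍ[ℝ]} (h : p ≠ 0) : (radial p : ℍ[ℝ]) = ‖p‖⁻¹ • p := by
  simp [radial, h]

lemma coe_ne_zero (g : S3) : (g : ℍ[ℝ]) ≠ 0 := ne_zero_of_mem_unit_sphere g

@[simp] lemma radial_coe (g : S3) : radial (g : ℍ[ℝ]) = g := by
  ext1
  simp [coe_radial (coe_ne_zero g)]

/-- Away from `0` the radial projection is smooth: it is a smooth map from the open submanifold
`ℍ ∖ {0}` to `ℍ` with values in the sphere. -/
lemma contMDiffAt_radial {p : ℍ[ℝ]} (hp : p ≠ 0) :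
    ContMDiffAt 𝓘(ℝ, ℍ[ℝ]) (𝓡 3) ∞ radial p := by
  let U : TopologicalSpace.Opens ℍ[ℝ] := ⟨{0}ᶜ, isOpen_compl_singleton⟩
  have key : ContMDiff 𝓘(ℝ, ℍ[ℝ]) 𝓘(ℝ, ℍ[ℝ]) ∞ (fun q : U => ‖(q : ℍ[ℝ])‖⁻¹ • (q : ℍ[ℝ])) := by
    intro q
    have hq : (q : ℍ[ℝ]) ≠ 0 := q.2
    have : ContDiffAt ℝ ∞ (fun q : ℍ[ℝ] => ‖q‖⁻¹ • q) (q : ℍ[ℝ]) :=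
      ((contDiffAt_norm ℝ hq).inv (norm_ne_zero_iff.2 hq)).smul contDiffAt_id
    exact contMDiffAt_subtype_iff.2 this.contMDiffAt
  have key2 := key.codRestrict_sphere (n := 3)
    (fun q => by
      have hq : (q : ℍ[ℝ]) ≠ 0 := q.2
      simp [norm_smul, hq])
  have h3 := key2 ⟨p, hp⟩
  refine (contMDiffAt_subtype_iff (U := U) (x := ⟨p, hp⟩) (f := radial)).1 ?_
  have e : (fun q : U => radial q) = Set.codRestrict (fun q : U => ‖(q : ℍ[ℝ])‖⁻¹ • (q : ℍ[ℝ]))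
      (sphere (0 : ℍ[ℝ]) 1) (fun q => by
        have hq : (q : ℍ[ℝ]) ≠ 0 := q.2
        simp [norm_smul, hq]) := by
    funext q
    ext1
    exact coe_radial q.2
  rw [e]
  exact h3

section Calculus

variable {E F : Type*} [NormedAddCommGroup E] [NormedSpace ℝ E]
  [NormedAddCommGroup F] [NormedSpace ℝ F]

/-- Every smooth function on `S³` extends to a smooth function on `ℍ ∖ {0}`, constant on rays, so
that calculus on `S³` reduces to Fréchet derivatives in `ℍ`. -/
lemma SmoothFun.contDiffAt_radial {f : S3 → E} (hf : SmoothFun f) {p : ℍ[ℝ]} (hp : p ≠ 0) :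
    ContDiffAt ℝ ∞ (fun q => f (radial q)) p :=
  ((hf (radial p)).comp p (contMDiffAt_radial hp)).contDiffAt

lemma SmoothFun.differentiableAt_radial {f : S3 → E} (hf : SmoothFun f) (g : S3) :
    DifferentiableAt ℝ (fun q => f (radial q)) (g : ℍ[ℝ]) :=
  (hf.contDiffAt_radial (coe_ne_zero g)).differentiableAt (by simp)

lemma smoothFun_of_contDiffAt {G : ℍ[ℝ] → E} (hG : ∀ g : S3, ContDiffAt ℝ ∞ G g) :
    SmoothFun (fun g : S3 => G g) := fun g =>
  (hG g).contMDiffAt.comp g (contMDiff_coe_sphere g)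

lemma mvfderiv_coe_tangentEquiv_symm (g : S3) (X : T g) :
    mvfderiv (𝓡 3) (Subtype.val : S3 → ℍ[ℝ]) g ((tangentEquiv g).symm X) = X :=
  congrArg Subtype.val ((tangentEquiv g).apply_symm_apply X)

/-- On the restriction to `S³` of a function on `ℍ`, the directional derivative is the ordinary
one. -/
lemma dirDeriv_restrict {G : ℍ[ℝ] → E} {g : S3} (hG : DifferentiableAt ℝ G g) (X : T g) :
    dirDeriv (fun h : S3 => G h) g X = fderiv ℝ G g X := by
  have hc : MDifferentiableAt (𝓡 3) 𝓘(ℝ, ℍ[ℝ]) (Subtype.val : S3 → ℍ[ℝ]) g :=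
    (contMDiff_coe_sphere (m := 1) g).mdifferentiableAt (by simp)
  have h1 := mfderiv_comp_apply g hG.mdifferentiableAt hc ((tangentEquiv g).symm X)
  rw [mfderiv_eq_fderiv] at h1
  have h2 := mvfderiv_coe_tangentEquiv_symm g X
  rw [← h2]
  exact h1

lemma SmoothFun.dirDeriv_eq {f : S3 → E} (hf : SmoothFun f) (g : S3) (X : T g) :
    dirDeriv f g X = fderiv ℝ (fun q => f (radial q)) g X := by
  rw [← dirDeriv_restrict (hf.differentiableAt_radial g)]
  simp

@[simp] lemma dirDeriv_coe (g : S3) (X : T g) :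
    dirDeriv (fun h : S3 => (h : ℍ[ℝ])) g X = X := by
  have := dirDeriv_restrict (G := fun q => q) (g := g) differentiableAt_id X
  simpa using this

@[simp] lemma dirDeriv_const (c : E) (g : S3) (X : T g) :
    dirDeriv (fun _ : S3 => c) g X = 0 := by
  have := dirDeriv_restrict (G := fun _ => c) (g := g) (differentiableAt_const c) X
  simpa using this

lemma dirDeriv_congr {f₁ f₂ : S3 → E} {g : S3} (h : f₁ =ᶠ[nhds g] f₂) (X : T g) :
    dirDeriv f₁ g X = dirDeriv f₂ g X := by
  simp only [dirDeriv, mvfderiv, LinearMap.comp_apply]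
  rw [h.mfderiv_eq, h.eq_of_nhds]

lemma dirDeriv_add {f₁ f₂ : S3 → E} (h₁ : SmoothFun f₁) (h₂ : SmoothFun f₂) (g : S3) (X : T g) :
    dirDeriv (fun h => f₁ h + f₂ h) g X = dirDeriv f₁ g X + dirDeriv f₂ g X := by
  have := dirDeriv_restrict
    ((h₁.differentiableAt_radial g).fun_add (h₂.differentiableAt_radial g)) X
  rw [fderiv_fun_add (h₁.differentiableAt_radial g) (h₂.differentiableAt_radial g)] at this
  simpa [h₁.dirDeriv_eq, h₂.dirDeriv_eq] using this

lemma dirDeriv_clm {f : S3 → E} (hf : SmoothFun f) (L : E →L[ℝ] F) (g : S3) (X : T g) :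
    dirDeriv (fun h => L (f h)) g X = L (dirDeriv f g X) := by
  have := dirDeriv_restrict (L.differentiableAt.comp (g : ℍ[ℝ]) (hf.differentiableAt_radial g)) X
  rw [fderiv_comp _ L.differentiableAt (hf.differentiableAt_radial g)] at this
  simpa [hf.dirDeriv_eq] using this

lemma dirDeriv_mul {A : Type*} [NormedRing A] [NormedAlgebra ℝ A] {f₁ f₂ : S3 → A}
    (h₁ : SmoothFun f₁) (h₂ : SmoothFun f₂) (g : S3) (X : T g) :
    dirDeriv (fun h => f₁ h * f₂ h) g X =
      f₁ g * dirDeriv f₂ g X + dirDeriv f₁ g X * f₂ g := by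
  have := dirDeriv_restrict
    (DifferentiableAt.fun_mul (h₁.differentiableAt_radial g) (h₂.differentiableAt_radial g)) X
  rw [fderiv_fun_mul' (h₁.differentiableAt_radial g) (h₂.differentiableAt_radial g)] at this
  simpa [h₁.dirDeriv_eq, h₂.dirDeriv_eq] using this

lemma smoothFun_coe : SmoothFun (fun h : S3 => (h : ℍ[ℝ])) := contMDiff_coe_sphere

lemma SmoothFun.continuous {f : S3 → E} (hf : SmoothFun f) : Continuous f :=
  ContMDiff.continuous hf

lemma smoothFun_const (c : E) : SmoothFun (fun _ : S3 => c) := contMDiff_const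

lemma SmoothFun.add {f₁ f₂ : S3 → E} (h₁ : SmoothFun f₁) (h₂ : SmoothFun f₂) :
    SmoothFun (fun h => f₁ h + f₂ h) := ContMDiff.add h₁ h₂

lemma SmoothFun.clm {f : S3 → E} (hf : SmoothFun f) (L : E →L[ℝ] F) :
    SmoothFun (fun h => L (f h)) := L.contDiff.contMDiff.comp hf

lemma SmoothFun.mul {A : Type*} [NormedRing A] [NormedAlgebra ℝ A] {f₁ f₂ : S3 → A}
    (h₁ : SmoothFun f₁) (h₂ : SmoothFun f₂) : SmoothFun (fun h => f₁ h * f₂ h) :=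
  contDiff_mul.contMDiff.comp (h₁.prodMk_space h₂)

lemma SmoothFun.dirDeriv {f : S3 → E} (hf : SmoothFun f) {Y : VField} (hY : SmoothVField Y) :
    SmoothFun (fun g => dirDeriv f g (Y g)) := by
  have h1 : SmoothFun (fun g : S3 => fderiv ℝ (fun q => f (radial q)) (g : ℍ[ℝ])) :=
    smoothFun_of_contDiffAt (G := fderiv ℝ (fun q => f (radial q))) fun g =>
      (hf.contDiffAt_radial (coe_ne_zero g)).fderiv_right (by simp)
  have h2 : SmoothFun (fun g : S3 => fderiv ℝ (fun q => f (radial q)) (g : ℍ[ℝ]) (Y g)) :=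
    ContMDiff.clm_apply h1 hY
  simpa only [hf.dirDeriv_eq] using h2

end Calculus

/-! ### The left invariant trivialization -/

lemma star_coe_mul_coe (g : S3) : star (g : ℍ[ℝ]) * (g : ℍ[ℝ]) = 1 := by
  rw [Quaternion.star_mul_self, Quaternion.normSq_eq_norm_mul_self]
  simp

lemma coe_mul_star_coe (g : S3) : (g : ℍ[ℝ]) * star (g : ℍ[ℝ]) = 1 := by
  rw [Quaternion.self_mul_star, Quaternion.normSq_eq_norm_mul_self]
  simp

lemma coe_inv (g : S3) : (g : ℍ[ℝ])⁻¹ = star (g : ℍ[ℝ]) :=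
  inv_eq_of_mul_eq_one_left (star_coe_mul_coe g)

lemma coe_mul_star_mul (g : S3) (x : ℍ[ℝ]) : (g : ℍ[ℝ]) * (star (g : ℍ[ℝ]) * x) = x := by
  rw [← mul_assoc, coe_mul_star_coe, one_mul]

lemma star_mul_coe_mul (g : S3) (x : ℍ[ℝ]) : star (g : ℍ[ℝ]) * ((g : ℍ[ℝ]) * x) = x := by
  rw [← mul_assoc, star_coe_mul_coe, one_mul]

lemma inner_coe_mul (g : S3) (x y : ℍ[ℝ]) :
    ⟪(g : ℍ[ℝ]) * x, y⟫_ℝ = ⟪x, star (g : ℍ[ℝ]) * y⟫_ℝ := by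
  simp only [Quaternion.inner_def, Quaternion.re_mul, Quaternion.re_star, Quaternion.imI_star,
    Quaternion.imJ_star, Quaternion.imK_star, Quaternion.imI_mul, Quaternion.imJ_mul,
    Quaternion.imK_mul]
  ring

lemma coe_mul_mem_T_iff (g : S3) (x : ℍ[ℝ]) : (g : ℍ[ℝ]) * x ∈ T g ↔ x.re = 0 := by
  rw [Submodule.mem_orthogonal_singleton_iff_inner_right]
  have : ⟪(g : ℍ[ℝ]), (g : ℍ[ℝ]) * x⟫_ℝ = x.re := by
    have := inner_coe_mul g 1 ((g : ℍ[ℝ]) * x)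
    rw [mul_one, star_mul_coe_mul] at this
    rw [this]
    simp [Quaternion.inner_def]
  rw [this]

lemma re_star_coe_mul {g : S3} (X : T g) : (star (g : ℍ[ℝ]) * (X : ℍ[ℝ])).re = 0 := by
  rw [← coe_mul_mem_T_iff g, coe_mul_star_mul]
  exact X.2

@[simp] lemma frame_apply (g : S3) (i : Fin 3) : frame g i = leftField i g := by
  simp [frame]

lemma inner_unitQ (i : Fin 3) (x : ℍ[ℝ]) : ⟪unitQ i, x⟫_ℝ = ![x.imI, x.imJ, x.imK] i := by
  rw [Quaternion.inner_def]
  simp only [Quaternion.re_mul, Quaternion.re_star, Quaternion.imI_star, Quaternion.imJ_star,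
    Quaternion.imK_star]
  fin_cases i <;> simp [unitQ]

lemma inner_leftField {g : S3} (i : Fin 3) (X : T g) :
    ⟪leftField i g, X⟫_ℝ = ⟪unitQ i, star (g : ℍ[ℝ]) * (X : ℍ[ℝ])⟫_ℝ := by
  rw [Submodule.coe_inner]
  exact inner_coe_mul g _ _

lemma sum_inner_leftField {g : S3} (X : T g) :
    ∑ i, ⟪leftField i g, X⟫_ℝ • leftField i g = X := by
  simpa using (frame g).sum_repr' X

lemma inner_covDeriv (V : VField) {g : S3} (X Y : T g) :
    ⟪Y, covDeriv V g X⟫_ℝ = ⟪(Y : ℍ[ℝ]), dirDeriv (fun h => (V h : ℍ[ℝ])) g X⟫_ℝ :=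
  Submodule.inner_orthogonalProjectionOnto_eq_of_mem_left Y _

/-- Spinor functions differentiate componentwise in the trivialization, up to the term
`½ X · Ψ`: the Christoffel symbols of the left invariant frame are those of the cross product. -/
lemma spinDeriv_eq (Ψ : Spinor) (g : S3) (X : T g) :
    spinDeriv Ψ g X = dirDeriv Ψ g X + (1 / 2 : ℝ) • clifford X (Ψ g) := by
  rw [spinDeriv]
  congr 1
  have hcov : ∀ i j, ⟪covDeriv (leftField i) g X, leftField j g⟫_ℝ =
      ⟪unitQ j, star (g : ℍ[ℝ]) * (X : ℍ[ℝ]) * unitQ i⟫_ℝ := by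
    intro i j
    have hd : dirDeriv (fun h => (leftField i h : ℍ[ℝ])) g X = (X : ℍ[ℝ]) * unitQ i := by
      have := dirDeriv_mul smoothFun_coe (smoothFun_const (unitQ i)) g X
      simpa [leftField] using this
    rw [real_inner_comm, inner_covDeriv, hd, leftField, inner_coe_mul, mul_assoc]
  simp only [hcov]
  simp only [clifford, coe_inv, leftField, star_mul_coe_mul]
  have hx := re_star_coe_mul X
  generalize star (g : ℍ[ℝ]) * (X : ℍ[ℝ]) = x at hx
  generalize Ψ g = φ
  simp only [Fin.sum_univ_three, inner_unitQ]
  ext <;>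
  simp only [Quaternion.re_mul, Quaternion.imI_mul, Quaternion.imJ_mul, Quaternion.imK_mul,
    Quaternion.re_add, Quaternion.imI_add, Quaternion.imJ_add, Quaternion.imK_add,
    Quaternion.re_smul, Quaternion.imI_smul, Quaternion.imJ_smul, Quaternion.imK_smul, hx] <;>
  simp [unitQ] <;> ring

lemma vol_apply (g : S3) (X : Fin 3 → T g) :
    vol g X = Matrix.det (Matrix.of fun i j => ⟪leftField i g, X j⟫_ℝ) := by
  rw [vol, Orientation.volumeForm_robust _ (frame g) rfl, Basis.det_apply]
  congr 1
  ext i j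
  simp [Basis.toMatrix_apply, OrthonormalBasis.repr_apply_apply]

/-! ### Unit generalized Killing spinors and symmetric Jacobians -/

lemma dirDeriv_norm_sq {f : S3 → ℍ[ℝ]} (hf : SmoothFun f) (g : S3) (X : T g) :
    dirDeriv (fun h => ‖f h‖ ^ 2) g X = 2 * ⟪f g, dirDeriv f g X⟫_ℝ := by
  have h := hf.differentiableAt_radial g
  have h1 := dirDeriv_restrict (h.norm_sq ℝ) X
  rw [h.hasFDerivAt.norm_sq.fderiv] at h1
  simpa [hf.dirDeriv_eq] using h1

/-- Quaternionic conjugation as a continuous linear map. -/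
def starCLM : ℍ[ℝ] →L[ℝ] ℍ[ℝ] :=
  LinearMap.toContinuousLinearMap
    { toFun := star
      map_add' := star_add
      map_smul' := fun r q => Quaternion.star_smul r q }

lemma smoothFun_star {f : S3 → ℍ[ℝ]} (hf : SmoothFun f) : SmoothFun (fun h => star (f h)) :=
  hf.clm starCLM

lemma dirDeriv_star {f : S3 → ℍ[ℝ]} (hf : SmoothFun f) (g : S3) (X : T g) :
    dirDeriv (fun h => star (f h)) g X = star (dirDeriv f g X) :=
  dirDeriv_clm hf starCLM g X

/-- The matrix, in the left invariant frame, of the `Im ℍ`-valued part of `dΨ · Ψ̄`. For a unit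
spinor this is `A - ½`, where `∇_X Ψ = A(X) · Ψ`. -/
def jacobian (Ψ : Spinor) (g : S3) (i j : Fin 3) : ℝ :=
  ⟪unitQ i, dirDeriv Ψ g (leftField j g) * star (Ψ g)⟫_ℝ

/-- The endomorphism `X ↦ g (dΨ(X) Ψ̄) + ½ X`. For a unit spinor the first summand is tangent to
`S³`, and projecting it changes nothing; without the projection the definition would need a
proof of that. -/
def killingEndo (Ψ : Spinor) (g : S3) : T g →ₗ[ℝ] T g :=
  (T g).orthogonalProjectionOnto.toLinearMap ∘ₗ LinearMap.mulLeft ℝ (g : ℍ[ℝ]) ∘ₗ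
    LinearMap.mulRight ℝ (star (Ψ g)) ∘ₗ dirDeriv Ψ g + (1 / 2 : ℝ) • LinearMap.id

lemma star_mul_self_of_norm_eq_one {q : ℍ[ℝ]} (hq : ‖q‖ = 1) : star q * q = 1 := by
  rw [Quaternion.star_mul_self, Quaternion.normSq_eq_norm_mul_self, hq]
  simp

lemma mul_star_self_of_norm_eq_one {q : ℍ[ℝ]} (hq : ‖q‖ = 1) : q * star q = 1 := by
  rw [Quaternion.self_mul_star, Quaternion.normSq_eq_norm_mul_self, hq]
  simp

/-- The derivative of a unit spinor is orthogonal to it, so `dΨ · Ψ̄` is purely imaginary. -/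
lemma re_dirDeriv_mul_star {Ψ : Spinor} (hΨ : SmoothFun Ψ) (h1 : ∀ g, ‖Ψ g‖ = 1) (g : S3)
    (X : T g) : (dirDeriv Ψ g X * star (Ψ g)).re = 0 := by
  have h := dirDeriv_norm_sq hΨ g X
  simp only [h1] at h
  rw [dirDeriv_const, real_inner_comm, Quaternion.inner_def] at h
  linarith

lemma coe_killingEndo {Ψ : Spinor} (hΨ : SmoothFun Ψ) (h1 : ∀ g, ‖Ψ g‖ = 1) (g : S3) (X : T g) :
    (killingEndo Ψ g X : ℍ[ℝ]) =
      (g : ℍ[ℝ]) * (dirDeriv Ψ g X * star (Ψ g)) + (1 / 2 : ℝ) • (X : ℍ[ℝ]) := by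
  have hm := (coe_mul_mem_T_iff g _).2 (re_dirDeriv_mul_star hΨ h1 g X)
  have hp := Submodule.starProjection_eq_self_iff.2 hm
  rw [← Submodule.coe_orthogonalProjectionOnto_apply] at hp
  simpa [killingEndo] using hp

lemma isSymmetric_iff_leftField {g : S3} (A : T g →ₗ[ℝ] T g) :
    A.IsSymmetric ↔ ∀ i j, ⟪leftField i g, A (leftField j g)⟫_ℝ =
      ⟪leftField j g, A (leftField i g)⟫_ℝ := by
  constructor
  · intro h i j
    rw [← h, real_inner_comm]
  · intro h X Y
    rw [← sum_inner_leftField X, ← sum_inner_leftField Y]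
    simp only [map_sum, map_smul, sum_inner, inner_sum, inner_smul_left, inner_smul_right]
    refine Finset.sum_congr rfl fun i _ => ?_
    congr 1
    refine Finset.sum_congr rfl fun j _ => ?_
    rw [← h, real_inner_comm (A _)]

/-- The equation `∇_X Ψ = Y · Ψ` for a unit spinor determines `Y`: the coefficients of `Y` are read
off after multiplication by `Ψ̄` on the right. -/
lemma inner_leftField_of_killing {Ψ : Spinor} {g : S3} (h1 : ‖Ψ g‖ = 1) {X Y : T g}
    (h : spinDeriv Ψ g X = clifford Y (Ψ g)) (i : Fin 3) :
    ⟪leftField i g, Y⟫_ℝ =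
      ⟪unitQ i, dirDeriv Ψ g X * star (Ψ g)⟫_ℝ + (1 / 2 : ℝ) * ⟪leftField i g, X⟫_ℝ := by
  rw [spinDeriv_eq] at h
  have h2 := congrArg (· * star (Ψ g)) h
  simp only [clifford, coe_inv, add_mul, smul_mul_assoc, mul_assoc,
    mul_star_self_of_norm_eq_one h1, mul_one] at h2
  rw [inner_leftField, inner_leftField, ← h2, inner_add_right, inner_smul_right]

/-- A smooth unit spinor is a generalized Killing spinor exactly when its Jacobian is symmetric
everywhere. -/
lemma isGeneralizedKilling_iff {Ψ : Spinor} (hΨ : SmoothFun Ψ) (h1 : ∀ g, ‖Ψ g‖ = 1) :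
    IsGeneralizedKilling Ψ ↔ ∀ g i j, jacobian Ψ g i j = jacobian Ψ g j i := by
  have hbasis : ∀ (g : S3) (i j : Fin 3),
      ⟪leftField i g, leftField j g⟫_ℝ = ⟪leftField j g, leftField i g⟫_ℝ :=
    fun g i j => real_inner_comm _ _
  have key : ∀ g (A : T g →ₗ[ℝ] T g), (∀ X, spinDeriv Ψ g X = clifford (A X) (Ψ g)) →
      (A.IsSymmetric ↔ ∀ i j, jacobian Ψ g i j = jacobian Ψ g j i) := by
    intro g A hA
    rw [isSymmetric_iff_leftField]
    refine forall_congr' fun i => forall_congr' fun j => ?_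
    rw [inner_leftField_of_killing (h1 g) (hA _), inner_leftField_of_killing (h1 g) (hA _),
      hbasis g i j, add_left_inj]
    rfl
  constructor
  · rintro ⟨-, A, -, hs, hA⟩ g
    exact (key g (A g) (hA g)).1 (hs g)
  · intro hJ
    have hA : ∀ g X, spinDeriv Ψ g X = clifford (killingEndo Ψ g X) (Ψ g) := by
      intro g X
      rw [spinDeriv_eq]
      simp only [clifford, coe_killingEndo hΨ h1, coe_inv, mul_add, add_mul, star_mul_coe_mul,
        mul_assoc, star_mul_self_of_norm_eq_one (h1 g), mul_one, mul_smul_comm, smul_mul_assoc]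
    refine ⟨hΨ, killingEndo Ψ, ?_, fun g => (key g _ (hA g)).2 (hJ g), hA⟩
    intro Y hY
    have h : SmoothFun fun g : S3 => (g : ℍ[ℝ]) * (dirDeriv Ψ g (Y g) * star (Ψ g)) +
        (1 / 2 : ℝ) • (Y g : ℍ[ℝ]) :=
      (smoothFun_coe.mul ((hΨ.dirDeriv hY).mul (smoothFun_star hΨ))).add
        (hY.clm ((1 / 2 : ℝ) • ContinuousLinearMap.id ℝ ℍ[ℝ]))
    simpa only [SmoothVField, coe_killingEndo hΨ h1] using h

lemma smoothVField_leftField (i : Fin 3) : SmoothVField (leftField i) :=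
  smoothFun_coe.mul (smoothFun_const (unitQ i))

lemma continuous_jacobian {Ψ : Spinor} (hΨ : SmoothFun Ψ) (i j : Fin 3) :
    Continuous fun g => jacobian Ψ g i j :=
  continuous_const.inner
    ((hΨ.dirDeriv (smoothVField_leftField j)).mul (smoothFun_star hΨ)).continuous

/-! ### The spinor `V · Φ + α Φ` in the left invariant frame -/

lemma spinorOf_apply (V : VField) (α : S3 → ℝ) (g : S3) :
    spinorOf V α g = star (g : ℍ[ℝ]) * (V g : ℍ[ℝ]) + α g • (1 : ℍ[ℝ]) := by
  rw [spinorOf, clifford, Phi, coe_inv, mul_one]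

lemma spinorOf_eq (V : VField) (α : S3 → ℝ) :
    spinorOf V α = fun g : S3 => star (g : ℍ[ℝ]) * (V g : ℍ[ℝ]) +
      ContinuousLinearMap.toSpanSingleton ℝ (1 : ℍ[ℝ]) (α g) :=
  funext fun g => by rw [spinorOf_apply, ContinuousLinearMap.toSpanSingleton_apply]

lemma re_spinorOf (V : VField) (α : S3 → ℝ) (g : S3) : (spinorOf V α g).re = α g := by
  rw [spinorOf_apply, Quaternion.re_add, re_star_coe_mul]
  simp

lemma inner_unitQ_one (i : Fin 3) : ⟪unitQ i, (1 : ℍ[ℝ])⟫_ℝ = 0 := by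
  rw [inner_unitQ]
  fin_cases i <;> simp

lemma inner_unitQ_spinorOf (V : VField) (α : S3 → ℝ) (g : S3) (i : Fin 3) :
    ⟪unitQ i, spinorOf V α g⟫_ℝ = ⟪leftField i g, V g⟫_ℝ := by
  rw [inner_leftField, spinorOf_apply, inner_add_right, inner_smul_right, inner_unitQ_one]
  simp

lemma smoothFun_spinorOf {V : VField} (hV : SmoothVField V) {α : S3 → ℝ} (hα : SmoothFun α) :
    SmoothFun (spinorOf V α) := by
  rw [spinorOf_eq]
  exact ((smoothFun_star smoothFun_coe).mul hV).add (hα.clm _)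

lemma dirDeriv_spinorOf {V : VField} (hV : SmoothVField V) {α : S3 → ℝ} (hα : SmoothFun α)
    (g : S3) (X : T g) :
    dirDeriv (spinorOf V α) g X = star (g : ℍ[ℝ]) * dirDeriv (fun h => (V h : ℍ[ℝ])) g X +
      star (X : ℍ[ℝ]) * (V g : ℍ[ℝ]) + dirDeriv α g X • (1 : ℍ[ℝ]) := by
  rw [spinorOf_eq, dirDeriv_add ((smoothFun_star smoothFun_coe).mul hV) (hα.clm _),
    dirDeriv_mul (smoothFun_star smoothFun_coe) hV, dirDeriv_clm hα,
    dirDeriv_star smoothFun_coe, dirDeriv_coe, ContinuousLinearMap.toSpanSingleton_apply]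

lemma re_dirDeriv_spinorOf {V : VField} (hV : SmoothVField V) {α : S3 → ℝ} (hα : SmoothFun α)
    (g : S3) (X : T g) :
    (dirDeriv (spinorOf V α) g X).re = dirDeriv α g X := by
  let L : ℍ[ℝ] →L[ℝ] ℝ := innerSL ℝ (1 : ℍ[ℝ])
  have hL : ∀ q, L q = q.re := fun q => by simp [L, Quaternion.inner_def]
  rw [← hL, ← dirDeriv_clm (smoothFun_spinorOf hV hα)]
  simp only [hL, re_spinorOf]

lemma star_unitQ (i : Fin 3) : star (unitQ i) = -unitQ i := by
  rw [Quaternion.star_eq_neg]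
  fin_cases i <;> rfl

/-- The coordinates of a vector field in the left invariant frame. -/
def coord (V : VField) (g : S3) (i : Fin 3) : ℝ := ⟪leftField i g, V g⟫_ℝ

/-- The matrix of `∇V` in the left invariant frame: entry `(i, j)` is `⟨u_i, ∇_{u_j} V⟩`. -/
def covMatrix (V : VField) (g : S3) (i j : Fin 3) : ℝ :=
  ⟪leftField i g, covDeriv V g (leftField j g)⟫_ℝ

/-- The vector `ω`, in the left invariant frame, with `B x - Bᵀ x = ω × x`, where `B` is the
Jacobian of the spinor `V · Φ + α Φ`, in terms of `V`, `∇V`, `α` and `dα`. -/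
def rotation (V : VField) (α : S3 → ℝ) (g : S3) : Fin 3 → ℝ :=
  let v := coord V g
  let N := covMatrix V g
  let a := fun i => dirDeriv α g (leftField i g)
  fun i => α g * (N (i + 2) (i + 1) - N (i + 1) (i + 2) + 2 * v i) +
    (v (i + 1) * a (i + 2) - v (i + 2) * a (i + 1)) + (∑ k, N k k) * v i - ∑ k, N i k * v k

/-- The antisymmetric part of the Jacobian of `V · Φ + α Φ` is `ω`. Indices are modulo 3, so that
`(i, i + 1, i + 2)` is always a cyclic permutation of the frame. -/
lemma jacobian_sub_jacobian {V : VField} (hV : SmoothVField V) {α : S3 → ℝ} (hα : SmoothFun α)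
    (g : S3) (i : Fin 3) :
    jacobian (spinorOf V α) g (i + 2) (i + 1) - jacobian (spinorOf V α) g (i + 1) (i + 2) =
      rotation V α g i := by
  have hq : ∀ i, ![(spinorOf V α g).imI, (spinorOf V α g).imJ, (spinorOf V α g).imK] i =
      coord V g i := fun i => by
    rw [← inner_unitQ, inner_unitQ_spinorOf, coord]
  -- With `f = g⁻¹ V + α`, the left invariance of the frame turns `g⁻¹ ∂_j V` into
  -- `∂_j f + e_j f` up to real multiples of `e_j` and `1`.
  have hd : ∀ i j, ![(dirDeriv (spinorOf V α) g (leftField j g)).imI,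
      (dirDeriv (spinorOf V α) g (leftField j g)).imJ,
      (dirDeriv (spinorOf V α) g (leftField j g)).imK] i =
      covMatrix V g i j - ⟪unitQ i, unitQ j * spinorOf V α g⟫_ℝ + α g * ⟪unitQ i, unitQ j⟫_ℝ := by
    intro i j
    have h1 : star ((leftField j g : T g) : ℍ[ℝ]) * (V g : ℍ[ℝ]) =
        - (unitQ j * spinorOf V α g) + α g • unitQ j := by
      rw [leftField, star_mul, star_unitQ, spinorOf_apply, mul_add, mul_smul_comm, mul_one,
        neg_mul, neg_mul, mul_assoc]
      abel
    rw [← inner_unitQ, dirDeriv_spinorOf hV hα, h1, covMatrix, inner_covDeriv,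
      show ((leftField i g : T g) : ℍ[ℝ]) = (g : ℍ[ℝ]) * unitQ i from rfl, inner_coe_mul]
    simp only [inner_add_right, inner_neg_right, inner_smul_right, inner_unitQ_one]
    ring
  have hr : ∀ j, (dirDeriv (spinorOf V α) g (leftField j g)).re =
      dirDeriv α g (leftField j g) := fun j => re_dirDeriv_spinorOf hV hα g _
  have hr0 := re_spinorOf V α g
  simp only [inner_unitQ] at hd
  simp only [jacobian, rotation, inner_unitQ, Quaternion.imI_mul, Quaternion.imJ_mul,
    Quaternion.imK_mul, Quaternion.re_star, Quaternion.imI_star, Quaternion.imJ_star,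
    Quaternion.imK_star, hr, hr0]
  simp only [Quaternion.imI_mul, Quaternion.imJ_mul, Quaternion.imK_mul, hr0] at hd
  generalize spinorOf V α g = f at *
  have d00 := hd 0 0
  have d01 := hd 0 1
  have d02 := hd 0 2
  have d10 := hd 1 0
  have d11 := hd 1 1
  have d12 := hd 1 2
  have d20 := hd 2 0
  have d21 := hd 2 1
  have d22 := hd 2 2
  have q0 := hq 0
  have q1 := hq 1
  have q2 := hq 2
  clear hd hq hr hr0
  simp [unitQ] at d00 d01 d02 d10 d11 d12 d20 d21 d22 q0 q1 q2
  fin_cases i <;> simp [Fin.sum_univ_three] <;>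
    simp only [d00, d01, d02, d10, d11, d12, d20, d21, d22, q0, q1, q2] <;> ring

/-! ### The three conditions in the left invariant frame -/

lemma sum_coord_smul (V : VField) (g : S3) : ∑ i, coord V g i • leftField i g = V g :=
  sum_inner_leftField (V g)

lemma map_eq_sum_coord {E : Type*} [AddCommGroup E] [Module ℝ E] (V : VField) (g : S3)
    (L : T g →ₗ[ℝ] E) : L (V g) = ∑ i, coord V g i • L (leftField i g) := by
  conv_lhs => rw [← sum_coord_smul V g]
  simp only [map_sum, map_smul]

lemma norm_sq_eq_sum_coord (V : VField) (g : S3) : ‖V g‖ ^ 2 = ∑ i, coord V g i ^ 2 := by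
  have h := (frame g).sum_sq_norm_inner_right (V g)
  simpa [coord] using h.symm

lemma inner_covDeriv_self (V : VField) (g : S3) (i : Fin 3) :
    ⟪leftField i g, covDeriv V g (V g)⟫_ℝ = ∑ k, coord V g k * covMatrix V g i k := by
  rw [map_eq_sum_coord, inner_sum]
  simp only [inner_smul_right, covMatrix]

lemma codiff_eq (V : VField) (g : S3) : codiff V g = -∑ i, covMatrix V g i i := by
  rw [codiff, LinearMap.trace_eq_sum_inner _ (frame g)]
  simp only [frame_apply, covMatrix]

lemma extD_leftField (V : VField) (g : S3) (i j : Fin 3) :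
    extD V g ![leftField i g, leftField j g] = covMatrix V g j i - covMatrix V g i j := by
  rw [extD, AlternatingMap.alternatizeUncurryFin_apply, covMatrix, covMatrix, inner_covDeriv,
    inner_covDeriv, real_inner_comm, real_inner_comm _ (leftField i g : ℍ[ℝ])]
  refine (Fin.sum_univ_two _).trans ?_
  simp [Fin.removeNth]
  ring

lemma starTop_wedge_extD (V : VField) (g : S3) :
    starTop (wedge (V g) (extD V g)) =
      ∑ i, coord V g i * (covMatrix V g (i + 2) (i + 1) - covMatrix V g (i + 1) (i + 2)) := by
  have h0 : Fin.removeNth 0 (fun i => leftField i g) = ![leftField 1 g, leftField 2 g] := by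
    funext i; fin_cases i <;> rfl
  have h1 : Fin.removeNth 1 (fun i => leftField i g) = ![leftField 0 g, leftField 2 g] := by
    funext i; fin_cases i <;> rfl
  have h2 : Fin.removeNth 2 (fun i => leftField i g) = ![leftField 0 g, leftField 1 g] := by
    funext i; fin_cases i <;> rfl
  have hf : (frame g : Fin 3 → T g) = fun i => leftField i g := funext (frame_apply g)
  rw [starTop, wedge, AlternatingMap.alternatizeUncurryFin_apply, hf]
  refine (Fin.sum_univ_three _).trans ?_
  simp only [Fin.sum_univ_three, h0, h1, h2, LinearMap.smulRight_apply, AlternatingMap.smul_apply,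
    extD_leftField, innerₛₗ_apply_apply, real_inner_comm _ (V g)]
  simp [coord]
  ring

/-- Differentiating `α² + |V|² = 1`. -/
lemma constraint_deriv {V : VField} (hV : SmoothVField V) {α : S3 → ℝ} (hα : SmoothFun α)
    (h1 : ∀ g, α g ^ 2 + ‖V g‖ ^ 2 = 1) (g : S3) (j : Fin 3) :
    α g * dirDeriv α g (leftField j g) + ∑ i, coord V g i * covMatrix V g i j = 0 := by
  have hn : SmoothFun fun h => ‖(V h : ℍ[ℝ])‖ ^ 2 := (contDiff_norm_sq ℝ).contMDiff.comp hV
  have h := dirDeriv_add (hα.mul hα) hn g (leftField j g)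
  have hc : (fun h => α h * α h + ‖(V h : ℍ[ℝ])‖ ^ 2) = fun _ => (1 : ℝ) := by
    funext h
    rw [← sq]
    exact h1 h
  have hs : ⟪(V g : ℍ[ℝ]), dirDeriv (fun h => (V h : ℍ[ℝ])) g (leftField j g)⟫_ℝ =
      ∑ i, coord V g i * covMatrix V g i j := by
    rw [← inner_covDeriv, real_inner_comm]
    have := map_eq_sum_coord V g (innerₛₗ ℝ (covDeriv V g (leftField j g)))
    rw [innerₛₗ_apply_apply] at this
    rw [this]
    refine Finset.sum_congr rfl fun i _ => ?_
    rw [innerₛₗ_apply_apply, real_inner_comm, smul_eq_mul, covMatrix]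
  rw [hc, dirDeriv_const, dirDeriv_mul hα hα, dirDeriv_norm_sq hV, hs] at h
  linarith

/-- The left-hand side of the second condition, a 1-form. -/
def secondForm (V : VField) (α : S3 → ℝ) (g : S3) : (T g) [⋀^Fin 1]→ₗ[ℝ] ℝ :=
  -interior (V g) (starVec (covDeriv V g (V g))) - flat (dirDeriv α g (V g) • V g) +
    flat (α g • covDeriv V g (V g)) + dFun α g

/-- The second condition says that `ω × V = 0`. -/
lemma secondForm_leftField {V : VField} (hV : SmoothVField V) {α : S3 → ℝ} (hα : SmoothFun α)
    (h1 : ∀ g, α g ^ 2 + ‖V g‖ ^ 2 = 1) (g : S3) (j : Fin 3) :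
    secondForm V α g (fun _ => leftField j g) =
      rotation V α g (j + 1) * coord V g (j + 2) - rotation V α g (j + 2) * coord V g (j + 1) := by
  have hvol : interior (V g) (starVec (covDeriv V g (V g))) (fun _ => leftField j g) =
      vol g ![covDeriv V g (V g), V g, leftField j g] := by
    rw [interior, starVec, interior, AlternatingMap.curryLeft_apply_apply,
      AlternatingMap.curryLeft_apply_apply]
    congr 1
    funext i
    fin_cases i <;> rfl
  have hu : ∀ i, ⟪leftField i g, leftField j g⟫_ℝ = if i = j then 1 else 0 := fun i =>
    orthonormal_iff_ite.1 (orthonormal_leftField g) i j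
  have hW := inner_covDeriv_self V g
  have hv : ∀ i, ⟪leftField i g, V g⟫_ℝ = coord V g i := fun i => rfl
  have hC := constraint_deriv hV hα h1 g
  have h0 := h1 g
  rw [norm_sq_eq_sum_coord] at h0
  have hda := map_eq_sum_coord V g (dirDeriv α g)
  have hflat : ∀ W : T g, flat W (fun _ => leftField j g) = ⟪leftField j g, W⟫_ℝ := fun W => by
    rw [real_inner_comm]
    rfl
  have hd : dFun α g (fun _ => leftField j g) = dirDeriv α g (leftField j g) := rfl
  simp only [secondForm, AlternatingMap.add_apply, AlternatingMap.sub_apply,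
    AlternatingMap.neg_apply, hvol, hflat, hd]
  simp only [inner_smul_right, hW, hv, hda, vol_apply, Matrix.det_fin_three,
    Matrix.of_apply, Matrix.cons_val_zero, Matrix.cons_val_one, Matrix.cons_val, hu, rotation,
    Fin.sum_univ_three, smul_eq_mul] at h0 hC ⊢
  have hj := hC j
  clear hC hda hW hv hvol hu hflat hd
  fin_cases j <;> simp at hj ⊢
  · linear_combination α g * hj - dirDeriv α g (leftField 0 g) * h0
  · linear_combination α g * hj - dirDeriv α g (leftField 1 g) * h0
  · linear_combination α g * hj - dirDeriv α g (leftField 2 g) * h0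

/-- The third condition says that `ω · V = 0`. -/
lemma third_eq {V : VField} (hV : SmoothVField V) {α : S3 → ℝ} (hα : SmoothFun α)
    (h1 : ∀ g, α g ^ 2 + ‖V g‖ ^ 2 = 1) (g : S3) :
    α g * starTop (wedge (V g) (extD V g)) + (2 * α g - codiff V g) * (1 - α g ^ 2) +
      α g * dirDeriv α g (V g) = ∑ i, rotation V α g i * coord V g i := by
  have hC := constraint_deriv hV hα h1 g
  have h0 := h1 g
  rw [norm_sq_eq_sum_coord] at h0
  rw [starTop_wedge_extD, codiff_eq, map_eq_sum_coord V g (dirDeriv α g)]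
  have c0 := hC 0
  have c1 := hC 1
  have c2 := hC 2
  simp only [Fin.sum_univ_three, rotation, smul_eq_mul] at *
  simp
  linear_combination (coord V g 0) * c0 + (coord V g 1) * c1 + (coord V g 2) * c2 -
    (2 * α g + (covMatrix V g 0 0 + covMatrix V g 1 1 + covMatrix V g 2 2)) * h0

/-! ### Where `V` vanishes -/

lemma norm_sq_spinorOf (V : VField) (α : S3 → ℝ) (g : S3) :
    ‖spinorOf V α g‖ ^ 2 = α g ^ 2 + ‖V g‖ ^ 2 := by
  have hq : ∀ i, ![(spinorOf V α g).imI, (spinorOf V α g).imJ, (spinorOf V α g).imK] i =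
      coord V g i := fun i => by
    rw [← inner_unitQ, inner_unitQ_spinorOf, coord]
  have q0 := hq 0
  have q1 := hq 1
  have q2 := hq 2
  simp only [Matrix.cons_val_zero, Matrix.cons_val_one, Matrix.cons_val] at q0 q1 q2
  rw [sq, ← Quaternion.normSq_eq_norm_mul_self, Quaternion.normSq_def', re_spinorOf, q0, q1, q2,
    norm_sq_eq_sum_coord, Fin.sum_univ_three]
  ring

lemma norm_spinorOf_eq_one_iff (V : VField) (α : S3 → ℝ) (g : S3) :
    ‖spinorOf V α g‖ = 1 ↔ α g ^ 2 + ‖V g‖ ^ 2 = 1 := by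
  rw [← norm_sq_spinorOf, pow_eq_one_iff_of_nonneg (norm_nonneg _) two_ne_zero]

/-- For `V · Φ + α Φ` the symmetry of the Jacobian at `g` means that `ω` vanishes at `g`. -/
lemma jacobian_symm_iff_rotation {V : VField} (hV : SmoothVField V) {α : S3 → ℝ}
    (hα : SmoothFun α) (g : S3) :
    (∀ i j, jacobian (spinorOf V α) g i j = jacobian (spinorOf V α) g j i) ↔
      ∀ i, rotation V α g i = 0 := by
  simp only [← jacobian_sub_jacobian hV hα, sub_eq_zero]
  refine ⟨fun h i => h _ _, fun h i j => ?_⟩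
  have h0 : jacobian (spinorOf V α) g 2 1 = jacobian (spinorOf V α) g 1 2 := h 0
  have h1 : jacobian (spinorOf V α) g 0 2 = jacobian (spinorOf V α) g 2 0 := h 1
  have h2 : jacobian (spinorOf V α) g 1 0 = jacobian (spinorOf V α) g 0 1 := h 2
  fin_cases i <;> fin_cases j <;> simp [h0, h1, h2]

lemma continuous_rotation {V : VField} (hV : SmoothVField V) {α : S3 → ℝ} (hα : SmoothFun α)
    (i : Fin 3) : Continuous fun g => rotation V α g i := by
  simp only [← jacobian_sub_jacobian hV hα]
  exact (continuous_jacobian (smoothFun_spinorOf hV hα) _ _).sub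
    (continuous_jacobian (smoothFun_spinorOf hV hα) _ _)

/-- Near a point where `V` vanishes identically the spinor is real-valued, so that the imaginary
part of `dΨ · Ψ̄` is zero. -/
lemma rotation_eq_zero_of_eventually {V : VField} (hV : SmoothVField V) {α : S3 → ℝ}
    (hα : SmoothFun α) {g : S3} (h : ∀ᶠ h in nhds g, V h = 0) (i : Fin 3) :
    rotation V α g i = 0 := by
  let L := ContinuousLinearMap.toSpanSingleton ℝ (1 : ℍ[ℝ])
  have he : spinorOf V α =ᶠ[nhds g] fun h => L (α h) := by
    filter_upwards [h] with p hp
    simp [spinorOf_apply, hp, L]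
  have hJ : ∀ i j, jacobian (spinorOf V α) g i j = 0 := by
    intro i j
    rw [jacobian, dirDeriv_congr he, he.eq_of_nhds, dirDeriv_clm hα]
    simp [L, inner_smul_right, inner_unitQ_one]
  rw [← jacobian_sub_jacobian hV hα, hJ, hJ, sub_zero]

/-- If `ω` vanishes wherever `V ≠ 0`, it vanishes everywhere: a point with `ω ≠ 0` would have a
neighbourhood on which `V = 0`. -/
lemma rotation_eq_zero {V : VField} (hV : SmoothVField V) {α : S3 → ℝ} (hα : SmoothFun α)
    (h : ∀ g, V g ≠ 0 → ∀ i, rotation V α g i = 0) (g : S3) (i : Fin 3) :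
    rotation V α g i = 0 := by
  by_contra hne
  refine hne (rotation_eq_zero_of_eventually hV hα ?_ i)
  filter_upwards [(continuous_rotation hV hα i).continuousAt.eventually_ne hne] with p hp
  by_contra hVp
  exact hp (h p hVp i)

lemma secondForm_eq_zero_iff (V : VField) (α : S3 → ℝ) (g : S3) :
    secondForm V α g = 0 ↔ ∀ j, secondForm V α g (fun _ => leftField j g) = 0 := by
  refine ⟨fun h j => by rw [h]; rfl, fun h => ?_⟩
  refine (frame g).toBasis.ext_alternating fun v _ => ?_
  have : (fun k => (frame g).toBasis (v k)) = fun _ => leftField (v 0) g := by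
    funext k
    rw [Subsingleton.elim k 0]
    simp
  rw [this, h]
  rfl

/-- `w × v = 0` and `w · v = 0` force `|v|² w = (w · v) v + v × (w × v) = 0`. -/
lemma cross_and_dot_eq_zero {w v : Fin 3 → ℝ}
    (hc : ∀ j : Fin 3, w (j + 1) * v (j + 2) - w (j + 2) * v (j + 1) = 0)
    (hd : ∑ i, w i * v i = 0) (i : Fin 3) : (∑ k, v k ^ 2) * w i = 0 := by
  have c0 : w 1 * v 2 - w 2 * v 1 = 0 := hc 0
  have c1 : w 2 * v 0 - w 0 * v 2 = 0 := hc 1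
  have c2 : w 0 * v 1 - w 1 * v 0 = 0 := hc 2
  simp only [Fin.sum_univ_three] at *
  fin_cases i
  · change _ * w 0 = 0
    linear_combination v 0 * hd + v 1 * c2 - v 2 * c1
  · change _ * w 1 = 0
    linear_combination v 1 * hd + v 2 * c0 - v 0 * c2
  · change _ * w 2 = 0
    linear_combination v 2 * hd + v 0 * c1 - v 1 * c0

end SphereSpin

end

/-! ### Unit generalized Killing spinors of the form `V · Φ + α Φ` -/

theorem mainTheorem9 (V : SphereSpin.VField) (hV : SphereSpin.SmoothVField V)
    (α : SphereSpin.S3 → ℝ) (hα : SphereSpin.SmoothFun α) :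
    (SphereSpin.IsGeneralizedKilling (SphereSpin.spinorOf V α) ∧
        ∀ g, ‖SphereSpin.spinorOf V α g‖ = 1) ↔
      (∀ g, α g ^ 2 + ‖V g‖ ^ 2 = 1) ∧
      (∀ g, -SphereSpin.interior (V g) (SphereSpin.starVec (SphereSpin.covDeriv V g (V g)))
          - SphereSpin.flat (SphereSpin.dirDeriv α g (V g) • V g)
          + SphereSpin.flat (α g • SphereSpin.covDeriv V g (V g))
          + SphereSpin.dFun α g = 0) ∧
      (∀ g, α g * SphereSpin.starTop (SphereSpin.wedge (V g) (SphereSpin.extD V g))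
          + (2 * α g - SphereSpin.codiff V g) * (1 - α g ^ 2)
          + α g * SphereSpin.dirDeriv α g (V g) = 0) := by
  have hnorm : (∀ g, ‖SphereSpin.spinorOf V α g‖ = 1) ↔ ∀ g, α g ^ 2 + ‖V g‖ ^ 2 = 1 :=
    forall_congr' (SphereSpin.norm_spinorOf_eq_one_iff V α)
  rw [hnorm, and_comm]
  refine and_congr_right fun h1 => ?_
  rw [SphereSpin.isGeneralizedKilling_iff (SphereSpin.smoothFun_spinorOf hV hα) (hnorm.2 h1)]
  simp only [SphereSpin.jacobian_symm_iff_rotation hV hα, SphereSpin.third_eq hV hα h1]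
  change _ ↔ (∀ g, SphereSpin.secondForm V α g = 0) ∧ _
  simp only [SphereSpin.secondForm_eq_zero_iff, SphereSpin.secondForm_leftField hV hα h1]
  constructor
  · intro h
    exact ⟨fun g j => by simp [h], fun g => by simp [h]⟩
  · rintro ⟨h2, h3⟩
    refine SphereSpin.rotation_eq_zero hV hα fun g hg i => ?_
    have h := SphereSpin.cross_and_dot_eq_zero (h2 g) (h3 g) i
    rw [← SphereSpin.norm_sq_eq_sum_coord] at h
    exact (mul_eq_zero.1 h).resolve_left (pow_ne_zero 2 (norm_ne_zero_iff.2 hg))
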